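/- Let $\mathcal A$ be a unital $C^*$-algebra and let $\mathcal B$ be a unital $C^*$-algebra. For unital completely positive maps $\phi_1,\phi_2:\mathcal A\to\mathcal B$, a joint representation tuple of $(\phi_1,\phi_2)$ is a tuple $(\mathcal E,\sigma_1,\sigma_2,x)$ consisting of a (right) Hilbert $\mathcal B$-module $\mathcal E$, two unital $*$-homomorphisms $\sigma_1,\sigma_2$ from $\mathcal A$ into the $C^*$-algebra $\mathcal B^a(\mathcal E)$ of bounded adjointable operators on $\mathcal E$, and a vector $x\in\mathcal E$ with $\langle x,x\rangle=1$, such that $\phi_i(a)=\langle x,\sigma_i(a)x\rangle$ for all $a\in\mathcal A$ and $i=1,2$. Put $$\gamma(\phi_1,\phi_2)=\inf_{(\mathcal E,\sigma_1,\sigma_2,x)}\|\sigma_1-\sigma_2\|_{cb},$$ the infimum being taken over all joint representation tuples of $(\phi_1,\phi_2)$. Suppose that $\mathcal B$ is injective, i.e. every completely positive map from a unital $C^*$-algebra $\mathcal C$ to $\mathcal B$ extends to a completely positive map on every unital $C^*$-algebra $\mathcal D$ that contains $\mathcal C$ as a unital $C^*$-subalgebra. Let $H$ be a Hilbert space and let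 $\iota:\mathcal B\to\mathcal B(H)$ be an injective unital $*$-homomorphism (for instance the inclusion, if $\mathcal B\subset\mathcal B(H)$). Then for all unital completely positive maps $\phi_1,\phi_2:\mathcal A\to\mathcal B$, $$\gamma(\iota\circ\phi_1,\iota\circ\phi_2)=\gamma(\phi_1,\phi_2),$$ where the left-hand side is computed for the range algebra $\mathcal B(H)$. -/

import Mathlib

open scoped ENNReal CStarAlgebra

universe u v w

/-- A unital completely positive map between unital C⋆-algebras. -/
structure UCPMap (A : Type u) (B : Type v)
    [CStarAlgebra A] [PartialOrder A] [StarOrderedRing A]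
    [CStarAlgebra B] [PartialOrder B] [StarOrderedRing B]
    extends CompletelyPositiveMap A B where
  map_one' : toFun 1 = 1

namespace UCPMap

section

variable {A : Type u} {B : Type v} {C : Type w}
  [CStarAlgebra A] [PartialOrder A] [StarOrderedRing A]
  [CStarAlgebra B] [PartialOrder B] [StarOrderedRing B]
  [CStarAlgebra C] [PartialOrder C] [StarOrderedRing C]

instance : FunLike (UCPMap A B) A B where
  coe φ := φ.toFun
  coe_injective φ ψ h := by
    obtain ⟨⟨f, hf⟩, h1⟩ := φ
    obtain ⟨⟨g, hg⟩, h2⟩ := ψ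
    congr
    exact DFunLike.coe_injective h

/-- A unital `⋆`-homomorphism, seen as a unital completely positive map. -/
noncomputable def ofStarAlgHom (π : A →⋆ₐ[ℂ] B) : UCPMap A B where
  toLinearMap := (π : A →ₗ[ℂ] B)
  map_cstarMatrix_nonneg' k M hM :=
    CompletelyPositiveMapClass.map_cstarMatrix_nonneg' π k M hM
  map_one' := map_one π

/-- The composition `ψ ∘ φ` of unital completely positive maps. -/
noncomputable def comp (ψ : UCPMap B C) (φ : UCPMap A B) : UCPMap A C where
  toLinearMap := ψ.toLinearMap ∘ₗ φ.toLinearMap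
  map_cstarMatrix_nonneg' k M hM :=
    ψ.map_cstarMatrix_nonneg' k _ (φ.map_cstarMatrix_nonneg' k M hM)
  map_one' := (congrArg ψ.toFun φ.map_one').trans ψ.map_one'

end

end UCPMap

/-- The unital C⋆-algebra `B` is injective: every completely positive map into `B` from a unital
C⋆-algebra `C` extends along every unital embedding of `C` into a unital C⋆-algebra `D`. -/
def IsInjectiveCStarAlgebra (B : Type v)
    [CStarAlgebra B] [PartialOrder B] [StarOrderedRing B] : Prop :=
  ∀ (C D : Type v)
    [CStarAlgebra C] [PartialOrder C] [StarOrderedRing C]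
    [CStarAlgebra D] [PartialOrder D] [StarOrderedRing D]
    (j : C →⋆ₐ[ℂ] D), Function.Injective j → ∀ θ : C →CP B,
      ∃ Θ : D →CP B, ∀ c : C, Θ (j c) = θ c

/-- A (right) Hilbert `B`-module: a complex Banach space `E` with a right action of `B`
(written `MulOpposite.op b • x` for `x b`) and a `B`-valued inner product, linear in the second
variable, which induces the norm. (Mathlib's `CStarModule` has `⟪x, a • y⟫ = a * ⟪x, y⟫`, that is,
it describes modules with a left action of the coefficient algebra.) -/
class HilbertModule (B : Type v) (E : Type w) [CStarAlgebra B] [PartialOrder B]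
    [NormedAddCommGroup E] [NormedSpace ℂ E] [Module Bᵐᵒᵖ E] where
  complete : CompleteSpace E
  /-- The `B`-valued inner product. -/
  inner : E → E → B
  inner_add_right : ∀ x y z, inner x (y + z) = inner x y + inner x z
  inner_smul_right : ∀ (c : ℂ) (x y), inner x (c • y) = c • inner x y
  inner_op_smul_right : ∀ (b : B) (x y), inner x (MulOpposite.op b • y) = inner x y * b
  star_inner : ∀ x y, star (inner x y) = inner y x
  inner_self_nonneg : ∀ x, 0 ≤ inner x x
  norm_eq_sqrt_norm_inner_self : ∀ x, ‖x‖ = √‖inner x x‖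

/-- A left action of `A` on the Hilbert `B`-module `E`: a unital `⋆`-homomorphism from `A` to the
C⋆-algebra of bounded adjointable operators on `E`, the operator of `star a` being the adjoint of
the operator of `a`. (Adjointable operators are automatically right `B`-linear.) -/
structure LeftAction (A : Type u) (B : Type v) (E : Type w) [CStarAlgebra A]
    [CStarAlgebra B] [PartialOrder B]
    [NormedAddCommGroup E] [NormedSpace ℂ E] [Module Bᵐᵒᵖ E] [HilbertModule B E] where
  /-- The underlying unital algebra homomorphism. -/
  toAlgHom : A →ₐ[ℂ] (E →L[ℂ] E)
  adjoint : ∀ (a : A) (x y : E), HilbertModule.inner (B := B) (toAlgHom a x) y =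
    HilbertModule.inner x (toAlgHom (star a) y)

section

variable {A : Type u} (B : Type v) {E : Type w}
  [CStarAlgebra A] [PartialOrder A] [StarOrderedRing A]
  [CStarAlgebra B] [PartialOrder B]
  [NormedAddCommGroup E] [NormedSpace ℂ E] [Module Bᵐᵒᵖ E] [HilbertModule B E]

/-- The norm of `ξ = (ξ₁, …, ξₙ)` in the Hilbert `B`-module `Eⁿ`, whose inner product is
`⟨ξ, η⟩ = ∑ i, ⟨ξ i, η i⟩`. -/
noncomputable def colNorm {n : ℕ} (ξ : Fin n → E) : ℝ :=
  √‖∑ i, HilbertModule.inner (B := B) (ξ i) (ξ i)‖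

/-- The action `(∑ j, T (M i j) (ξ j))ᵢ` on `ξ ∈ Eⁿ` of the `n`-th ampliation
`T⁽ⁿ⁾(M) = (T (M i j))ᵢⱼ` of a map `T` from `A` to operators on `E`. -/
def ampliation {n : ℕ} (T : A → (E →L[ℂ] E)) (M : CStarMatrix (Fin n) (Fin n) A)
    (ξ : Fin n → E) : Fin n → E :=
  fun i => ∑ j, T (M i j) (ξ j)

/-- The completely bounded norm `sup { ‖T⁽ⁿ⁾(M)‖ : n ∈ ℕ, M ∈ Mₙ(A), ‖M‖ ≤ 1 }` of a map `T`
from `A` to the adjointable operators on `E`, where `Mₙ` of these operators acts on `Eⁿ` and so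
carries the operator norm for `colNorm`. -/
noncomputable def cbNorm (T : A → (E →L[ℂ] E)) : ℝ≥0∞ :=
  ⨆ (n : ℕ) (M : CStarMatrix (Fin n) (Fin n) A) (_ : ‖M‖ ≤ 1)
    (ξ : Fin n → E) (_ : colNorm B ξ ≤ 1), ENNReal.ofReal (colNorm B (ampliation T M ξ))

end

section

variable {A : Type u} {B : Type v}
  [CStarAlgebra A] [PartialOrder A] [StarOrderedRing A]
  [CStarAlgebra B] [PartialOrder B] [StarOrderedRing B]

/-- `(E, σ₁, σ₂, x)` is a joint representation tuple of `(φ₁, φ₂)`. -/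
structure IsJointRepresentation {E : Type w} [NormedAddCommGroup E] [NormedSpace ℂ E]
    [Module Bᵐᵒᵖ E] [HilbertModule B E] (φ₁ φ₂ : UCPMap A B)
    (σ₁ σ₂ : LeftAction A B E) (x : E) : Prop where
  unit : HilbertModule.inner (B := B) x x = 1
  left : ∀ a : A, φ₁ a = HilbertModule.inner x (σ₁.toAlgHom a x)
  right : ∀ a : A, φ₂ a = HilbertModule.inner x (σ₂.toAlgHom a x)

/-- The representation metric `γ(φ₁, φ₂)`: the infimum of `‖σ₁ - σ₂‖_cb` over all joint
representation tuples `(E, σ₁, σ₂, x)` of `(φ₁, φ₂)`. Restricting the carrier `E` to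
`Type (max u v)` loses nothing, as each tuple contains one that is generated by
`A`, `x` and `B`, with no larger cb-norm. -/
noncomputable def representationMetric (φ₁ φ₂ : UCPMap A B) : ℝ≥0∞ :=
  sInf {r : ℝ≥0∞ | ∃ (E : Type (max u v)) (_ : NormedAddCommGroup E) (_ : NormedSpace ℂ E)
    (_ : Module Bᵐᵒᵖ E) (_ : HilbertModule B E) (σ₁ σ₂ : LeftAction A B E) (x : E),
    IsJointRepresentation φ₁ φ₂ σ₁ σ₂ x ∧
      r = cbNorm B (fun a => σ₁.toAlgHom a - σ₂.toAlgHom a)}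

end

/-! The representation metric decreases under postcomposition with any unital completely positive `ψ
: B → C` (`representationMetric_comp_le`). Equality follows by applying this twice: to `ι`, and to a
unital completely positive left inverse of `ι`, which injectivity of `B` provides by extending the
identity of `B` along `ι`.

For the monotonicity, a tuple `(E, σ₁, σ₂, x)` over `B` is transported to `F = E ⊗_ψ C`, the
completion of the span of `e ⊗ c` for `⟨e ⊗ c, e' ⊗ c'⟩ = c* ψ(⟨e, e'⟩) c'`, with actions `σᵢ ⊗ id`
and vector `x ⊗ 1`. The form is positive because `ψ` preserves positive definite kernels
(`CompletelyPositiveMap.form_nonneg`).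

The cb-norm does not grow: a norm bound for a right `B`-linear map upgrades to the `B`-valued
inequality `⟨Tη, Tη⟩ ≤ t² ⟨η, η⟩` (`HilbertModule.sum_inner_map_le`). Applied to all
`B`-combinations of a finite family, it says that a difference of Gram kernels is positive definite,
and this survives `ψ` (`IsInteriorTensor.sum_inner_le`). Density then gives the bound on all of
`Fⁿ`. -/

/-! ### Positivity of matrices and kernels over a C⋆-algebra -/

section Kernel

/-- If `a * a * a = 0` with `a` self-adjoint, then `a = 0`. -/
lemma IsSelfAdjoint.eq_zero_of_mul_mul_self {R : Type*} [NonUnitalCStarAlgebra R] {a : R}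
    (ha : IsSelfAdjoint a) (h : a * a * a = 0) : a = 0 := by
  have h2 : a * a = 0 := by
    rw [← CStarRing.star_mul_self_eq_zero_iff, star_mul, ha.star_eq, ← mul_assoc, h, zero_mul]
  rw [← CStarRing.star_mul_self_eq_zero_iff, ha.star_eq, h2]

/-- Conjugating a self-adjoint element by its negative part gives a nonpositive element, which
vanishes only if the given element is nonnegative. -/
lemma IsSelfAdjoint.exists_star_conjugate_eq_neg {R : Type*} [NonUnitalCStarAlgebra R]
    [PartialOrder R] [StarOrderedRing R] {a : R} (ha : IsSelfAdjoint a) :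
    ∃ x y : R, star x * a * x = -(star y * y) ∧ (star y * y = 0 → 0 ≤ a) := by
  have hX : IsSelfAdjoint a⁻ := (CFC.negPart_nonneg a).isSelfAdjoint
  obtain ⟨y, hy⟩ := CStarAlgebra.nonneg_iff_eq_star_mul_self.mp
    (star_left_conjugate_nonneg (CFC.negPart_nonneg a) a⁻)
  refine ⟨a⁻, y, ?_, fun h => ?_⟩
  · rw [← hy, hX.star_eq]
    conv_lhs => enter [1, 2]; rw [← CFC.posPart_sub_negPart a ha]
    simp [mul_sub, CFC.negPart_mul_posPart]
  · rw [← hy, hX.star_eq] at h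
    exact (CFC.negPart_eq_zero_iff a ha).mp (hX.eq_zero_of_mul_mul_self h)

lemma CStarAlgebra.exists_eq_star_mul_self {R : Type*} [NonUnitalCStarAlgebra R]
    [PartialOrder R] [StarOrderedRing R] {a : R} (ha : 0 ≤ a) : ∃ y : R, a = star y * y :=
  CStarAlgebra.nonneg_iff_eq_star_mul_self.mp ha

variable {B : Type v} {C : Type w}
  [CStarAlgebra B] [PartialOrder B] [StarOrderedRing B]
  [CStarAlgebra C] [PartialOrder C] [StarOrderedRing C]

/-- Each diagonal entry is a sum of squares of the entries in one column of `Y`, so it can be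
nonpositive only if that column vanishes. -/
lemma CStarMatrix.star_mul_self_eq_zero_of_diag_nonpos {n : Type*} [Fintype n]
    {Y : CStarMatrix n n B} (h : ∀ j, (star Y * Y) j j ≤ 0) : star Y * Y = 0 := by
  have hY : Y = 0 := by
    ext k j
    have hsum : (star Y * Y) j j = ∑ k, star (Y k j) * Y k j := by
      simp [CStarMatrix.mul_apply, CStarMatrix.star_apply]
    have h0 : ∑ k, star (Y k j) * Y k j = 0 :=
      le_antisymm (hsum ▸ h j) (Finset.sum_nonneg fun k _ => star_mul_self_nonneg _)
    rw [Finset.sum_eq_zero_iff_of_nonneg fun k _ => star_mul_self_nonneg _] at h0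
    exact (CStarRing.star_mul_self_eq_zero_iff _).mp (h0 k (Finset.mem_univ k))
  rw [hY, mul_zero]

/-- A self-adjoint matrix over a C⋆-algebra is positive if its quadratic form is. -/
lemma CStarMatrix.nonneg_of_form_nonneg {n : Type*} [Fintype n]
    {M : CStarMatrix n n B} (hM : IsSelfAdjoint M)
    (h : ∀ b : n → B, 0 ≤ ∑ i, ∑ j, star (b i) * M i j * b j) : 0 ≤ M := by
  obtain ⟨X, Y, hXY, hpos⟩ := hM.exists_star_conjugate_eq_neg
  refine hpos (CStarMatrix.star_mul_self_eq_zero_of_diag_nonpos fun j => ?_)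
  have h1 : (star X * M * X) j j = ∑ i, ∑ k, star (X i j) * M i k * X k j := by
    simp only [CStarMatrix.mul_apply, CStarMatrix.star_apply, Finset.sum_mul]
    rw [Finset.sum_comm]
  -- The columns of `X` are the test vectors: the form at column `j` is the `j`-th diagonal entry of
  -- `star X * M * X = -(star Y * Y)`.
  have h2 := h fun i => X i j
  rw [← h1, hXY] at h2
  exact neg_nonneg.mp h2

/-- A completely positive map sends positive definite kernels to positive definite kernels. -/
lemma CompletelyPositiveMap.form_nonneg (ψ : B →CP C) {n : Type*} [Fintype n]
    {G : n → n → B} (hG : ∀ i j, star (G i j) = G j i)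
    (h : ∀ b : n → B, 0 ≤ ∑ i, ∑ j, star (b i) * G i j * b j) (c : n → C) :
    0 ≤ ∑ i, ∑ j, star (c i) * ψ (G i j) * c j := by
  let M : CStarMatrix n n B := CStarMatrix.ofMatrix G
  have hM : 0 ≤ M := by
    refine CStarMatrix.nonneg_of_form_nonneg ?_ h
    ext i j
    exact hG j i
  -- Factoring the image matrix turns the form at `c` into the sum of squares of the entries of `Y
  -- c`.
  obtain ⟨Y, hY⟩ : ∃ Y : CStarMatrix n n C, M.map ψ = star Y * Y :=
    CStarAlgebra.exists_eq_star_mul_self (ψ.map_cstarMatrix_nonneg M hM)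
  have hY' : ∀ i j, ψ (G i j) = ∑ k, star (Y k i) * Y k j := fun i j => by
    have : (M.map ψ) i j = (star Y * Y) i j := by rw [hY]
    exact this.trans (by simp only [CStarMatrix.mul_apply, CStarMatrix.star_apply])
  have : ∑ i, ∑ j, star (c i) * ψ (G i j) * c j =
      ∑ k, star (∑ i, Y k i * c i) * ∑ j, Y k j * c j := by
    simp only [hY', star_sum, star_mul, Finset.sum_mul, Finset.mul_sum, mul_assoc]
    rw [Finset.sum_comm]
    refine (Finset.sum_congr rfl fun i _ => Finset.sum_comm).trans ?_
    rw [Finset.sum_comm]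
  rw [this]
  exact Finset.sum_nonneg fun k _ => star_mul_self_nonneg _

/-- If `r` is bounded by `t` after each normalization of `s`, then `r ≤ t s`. -/
lemma CStarAlgebra.le_smul_of_forall_conjugate {r s : B} {t : ℝ} (hr : 0 ≤ r) (hs : 0 ≤ s)
    (h : ∀ b : B, ‖star b * s * b‖ ≤ 1 → ‖star b * r * b‖ ≤ t) : r ≤ t • s := by
  have ht : 0 ≤ t := by simpa using h 0 (by simp)
  -- `s` need not be invertible, so `a = s + ε` replaces it. Conjugating by `a ^ (-1/2)` normalizes
  -- `s`, conjugating by `a ^ (1/2)` undoes this, and finally `ε → 0`.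
  have key : ∀ ε : ℝ, 0 < ε → r ≤ t • (s + ε • (1 : B)) := by
    intro ε hε
    set a := s + ε • (1 : B) with ha_def
    have ha1 : IsStrictlyPositive (ε • (1 : B)) :=
      ⟨smul_nonneg hε.le zero_le_one, (isUnit_one.smul (Units.mk0 ε hε.ne'))⟩
    have ha : IsStrictlyPositive a := IsStrictlyPositive.nonneg_add hs ha1
    set b := a ^ (-(1 / 2) : ℝ)
    set d := a ^ (1 / 2 : ℝ)
    have hbd : b * d = 1 := CFC.rpow_neg_mul_rpow _ ha
    have hb : star b = b := (IsSelfAdjoint.of_nonneg CFC.rpow_nonneg).star_eq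
    have hd : star d = d := (IsSelfAdjoint.of_nonneg CFC.rpow_nonneg).star_eq
    have hdb : d * b = 1 := by simpa [hb, hd] using congrArg star hbd
    have hdd : d * d = a := by
      have h1 : b * a * b = 1 := CFC.conjugate_rpow_neg_one_half a ha
      calc d * d = d * (b * a * b) * d := by rw [h1, mul_one]
        _ = (d * b) * a * (b * d) := by simp only [mul_assoc]
        _ = a := by rw [hdb, hbd, one_mul, mul_one]
    have hsb : star b * s * b ≤ 1 := by
      calc star b * s * b ≤ star b * a * b :=
            star_left_conjugate_le_conjugate (le_add_of_nonneg_right ha1.nonneg) b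
        _ = 1 := by rw [hb]; exact CFC.conjugate_rpow_neg_one_half a ha
    have hrb := h b
      ((CStarAlgebra.norm_le_one_iff_of_nonneg _ (star_left_conjugate_nonneg hs b)).mpr hsb)
    have hrb' : star b * r * b ≤ algebraMap ℝ B t :=
      (CStarAlgebra.norm_le_iff_le_algebraMap _ ht (star_left_conjugate_nonneg hr b)).mp hrb
    calc r = star d * (star b * r * b) * d := by
          rw [hd, hb]
          calc r = (d * b) * r * (b * d) := by rw [hdb, hbd, one_mul, mul_one]
            _ = _ := by simp only [mul_assoc]
      _ ≤ star d * algebraMap ℝ B t * d := star_left_conjugate_le_conjugate hrb' d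
      _ = t • a := by
          rw [Algebra.algebraMap_eq_smul_one, mul_smul_comm, mul_one, smul_mul_assoc, hd, hdd]
  have hlim : Filter.Tendsto (fun ε : ℝ => t • (s + ε • (1 : B))) (nhdsWithin 0 (Set.Ioi 0))
      (nhds (t • s)) := by
    have : Continuous fun ε : ℝ => t • (s + ε • (1 : B)) := by fun_prop
    simpa using (this.tendsto 0).mono_left nhdsWithin_le_nhds
  exact ge_of_tendsto hlim (Filter.eventually_of_mem self_mem_nhdsWithin key)

end Kernel

/-! ### Semi-inner products and their completions -/

/-- A positive semidefinite `C`-valued inner product on a right `C`-module `W`. -/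
structure SemiInner (C : Type v) (W : Type w) [CStarAlgebra C] [PartialOrder C]
    [AddCommGroup W] [Module ℂ W] [Module Cᵐᵒᵖ W] where
  /-- The `C`-valued inner product. -/
  inner : W → W → C
  add_right : ∀ x y z, inner x (y + z) = inner x y + inner x z
  smul_right : ∀ (c : ℂ) (x y), inner x (c • y) = c • inner x y
  op_smul_right : ∀ (b : C) (x y), inner x (MulOpposite.op b • y) = inner x y * b
  star_inner : ∀ x y, star (inner x y) = inner y x
  self_nonneg : ∀ x, 0 ≤ inner x x

namespace SemiInner

variable {C : Type v} {W : Type w} [CStarAlgebra C] [PartialOrder C] [AddCommGroup W]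
  [Module ℂ W] [Module Cᵐᵒᵖ W] (s : SemiInner C W)

lemma add_left (x y z : W) : s.inner (x + y) z = s.inner x z + s.inner y z := by
  rw [← s.star_inner, s.add_right, star_add, s.star_inner, s.star_inner]

lemma smul_left (c : ℂ) (x y : W) : s.inner (c • x) y = star c • s.inner x y := by
  rw [← s.star_inner, s.smul_right, star_smul, s.star_inner]

lemma op_smul_left (b : C) (x y : W) :
    s.inner (MulOpposite.op b • x) y = star b * s.inner x y := by
  rw [← s.star_inner, s.op_smul_right, star_mul, s.star_inner]

lemma sub_right (x y z : W) : s.inner x (y - z) = s.inner x y - s.inner x z := by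
  rw [eq_sub_iff_add_eq, ← s.add_right, sub_add_cancel]

lemma sub_left (x y z : W) : s.inner (x - y) z = s.inner x z - s.inner y z := by
  rw [eq_sub_iff_add_eq, ← s.add_left, sub_add_cancel]

lemma sum_right {ι : Type*} (t : Finset ι) (x : W) (y : ι → W) :
    s.inner x (∑ i ∈ t, y i) = ∑ i ∈ t, s.inner x (y i) :=
  map_sum (AddMonoidHom.mk' (s.inner x) (s.add_right x)) y t

lemma sum_left {ι : Type*} (t : Finset ι) (x : ι → W) (y : W) :
    s.inner (∑ i ∈ t, x i) y = ∑ i ∈ t, s.inner (x i) y :=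
  map_sum (AddMonoidHom.mk' (s.inner · y) (s.add_left · · y)) x t

/-- The seminorm of a semi-inner product. -/
noncomputable def norm (x : W) : ℝ := √‖s.inner x x‖

lemma norm_nonneg (x : W) : 0 ≤ s.norm x := Real.sqrt_nonneg _

lemma norm_sq (x : W) : s.norm x ^ 2 = ‖s.inner x x‖ := Real.sq_sqrt (_root_.norm_nonneg _)

lemma norm_smul (c : ℂ) (x : W) : s.norm (c • x) = ‖c‖ * s.norm x := by
  rw [norm, s.smul_left, s.smul_right, _root_.norm_smul, _root_.norm_smul, norm_star, ← mul_assoc,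
    Real.sqrt_mul (by positivity), Real.sqrt_mul_self (_root_.norm_nonneg c), norm]

lemma norm_op_smul_le (b : C) (x : W) : s.norm (MulOpposite.op b • x) ≤ ‖b‖ * s.norm x := by
  refine Real.sqrt_le_iff.mpr ⟨mul_nonneg (_root_.norm_nonneg b) (s.norm_nonneg x), ?_⟩
  rw [s.op_smul_left, s.op_smul_right, mul_pow, s.norm_sq]
  calc ‖star b * (s.inner x x * b)‖ ≤ ‖star b‖ * (‖s.inner x x‖ * ‖b‖) :=
        (norm_mul_le _ _).trans (by gcongr; exact norm_mul_le _ _)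
    _ = ‖b‖ ^ 2 * ‖s.inner x x‖ := by rw [norm_star]; ring

variable [StarOrderedRing C]

/-- Cauchy–Schwarz: expand `⟨xb - y, xb - y⟩ ≥ 0` at `b = r⁻¹ ⟨x, y⟩`. Taking `r` strictly above
`‖x‖²` and then letting it decrease to `‖x‖²` avoids dividing by a vanishing seminorm. -/
lemma norm_inner_le (x y : W) : ‖s.inner x y‖ ≤ s.norm x * s.norm y := by
  set g := s.inner x y with hg
  have key : ∀ r : ℝ, s.norm x ^ 2 < r → ‖g‖ ^ 2 ≤ r * s.norm y ^ 2 := by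
    intro r hr
    have hr0 : 0 < r := (sq_nonneg _).trans_lt hr
    set b : C := (r⁻¹ : ℝ) • g with hb
    have h0 : 0 ≤ star b * s.inner x x * b - star b * g - star g * b + s.inner y y := by
      have := s.self_nonneg (MulOpposite.op b • x - y)
      rw [s.sub_left, s.sub_right, s.sub_right, s.op_smul_left, s.op_smul_left, s.op_smul_right,
        s.op_smul_right, ← s.star_inner x y, ← hg] at this
      convert this using 1
      rw [mul_assoc]
      abel
    have h1 : star b * s.inner x x * b ≤ r • (star b * b) := by
      refine (CStarAlgebra.star_left_conjugate_le_norm_smul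
        (IsSelfAdjoint.of_nonneg (s.self_nonneg x))).trans ?_
      rw [← s.norm_sq]
      exact smul_le_smul_of_nonneg_right hr.le (star_mul_self_nonneg b)
    have h2 : star g * g ≤ r • s.inner y y := by
      have h3 : 0 ≤ r • (star b * b) - star b * g - star g * b + s.inner y y :=
        h0.trans (by gcongr)
      have h4 : r • (star b * b) - star b * g - star g * b + s.inner y y =
          s.inner y y - r⁻¹ • (star g * g) := by
        have : r * (r⁻¹ * r⁻¹) = r⁻¹ := by field_simp
        simp only [hb, star_smul, star_trivial, smul_mul_assoc, mul_smul_comm, smul_smul, this]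
        abel
      rw [h4, sub_nonneg] at h3
      have h5 := smul_le_smul_of_nonneg_left h3 hr0.le
      rwa [smul_smul, mul_inv_cancel₀ hr0.ne', one_smul] at h5
    calc ‖g‖ ^ 2 = ‖star g * g‖ := by rw [CStarRing.norm_star_mul_self, sq]
      _ ≤ ‖r • s.inner y y‖ :=
        CStarAlgebra.norm_le_norm_of_nonneg_of_le (star_mul_self_nonneg g) h2
      _ = r * s.norm y ^ 2 := by
        rw [_root_.norm_smul, s.norm_sq, Real.norm_of_nonneg hr0.le]
  have hlim : Filter.Tendsto (fun r : ℝ => r * s.norm y ^ 2)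
      (nhdsWithin (s.norm x ^ 2) (Set.Ioi (s.norm x ^ 2)))
      (nhds (s.norm x ^ 2 * s.norm y ^ 2)) := by
    have : Continuous fun r : ℝ => r * s.norm y ^ 2 := by fun_prop
    exact (this.tendsto _).mono_left nhdsWithin_le_nhds
  have h := ge_of_tendsto hlim (Filter.eventually_of_mem self_mem_nhdsWithin key)
  rw [← mul_pow] at h
  exact (pow_le_pow_iff_left₀ (_root_.norm_nonneg g)
    (mul_nonneg (s.norm_nonneg x) (s.norm_nonneg y)) two_ne_zero).mp h

lemma norm_add_le (x y : W) : s.norm (x + y) ≤ s.norm x + s.norm y := by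
  refine Real.sqrt_le_iff.mpr ⟨add_nonneg (s.norm_nonneg x) (s.norm_nonneg y), ?_⟩
  rw [s.add_left, s.add_right, s.add_right]
  have h1 := s.norm_inner_le x y
  have h2 := s.norm_inner_le y x
  have h3 := s.norm_sq x
  have h4 := s.norm_sq y
  calc ‖s.inner x x + s.inner x y + (s.inner y x + s.inner y y)‖
      ≤ ‖s.inner x x‖ + ‖s.inner x y‖ + (‖s.inner y x‖ + ‖s.inner y y‖) :=
        norm_add_le_of_le (_root_.norm_add_le _ _) (_root_.norm_add_le _ _)
    _ ≤ (s.norm x + s.norm y) ^ 2 := by nlinarith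

/-- Separation and completion happen at once; right multiplication by `b` extends because it is
Lipschitz with constant `‖b‖`. -/
lemma exists_banach_completion : ∃ (F : Type w) (_ : NormedAddCommGroup F) (_ : NormedSpace ℂ F)
    (_ : Module Cᵐᵒᵖ F) (_ : CompleteSpace F) (j : W →ₗ[ℂ] F), DenseRange j ∧
      (∀ x, ‖j x‖ = s.norm x) ∧ (∀ (b : C) (x : W), j (MulOpposite.op b • x) =
        MulOpposite.op b • j x) ∧ ∀ b : Cᵐᵒᵖ, Continuous fun x : F => b • x := by
  let : Norm W := ⟨s.norm⟩
  have core : SeminormedSpace.Core ℂ W := ⟨s.norm_nonneg, s.norm_smul, s.norm_add_le⟩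
  let : SeminormedAddCommGroup W := SeminormedAddCommGroup.ofCore core
  let : NormedSpace ℂ W := { norm_smul_le := fun c x => (s.norm_smul c x).le }
  have : UniformContinuousConstSMul Cᵐᵒᵖ W := ⟨fun b =>
    (AddMonoidHomClass.lipschitz_of_bound (DistribSMul.toAddMonoidHom W b) ‖b.unop‖
      fun x => s.norm_op_smul_le b.unop x).uniformContinuous⟩
  refine ⟨UniformSpace.Completion W, inferInstance, inferInstance, inferInstance, inferInstance,
    (UniformSpace.Completion.toComplL : W →L[ℂ] _).toLinearMap,
    UniformSpace.Completion.denseRange_coe, fun x => UniformSpace.Completion.norm_coe x,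
    fun b x => UniformSpace.Completion.coe_smul _ _, fun b => continuous_const_smul b⟩

/-- Every semi-inner product arises from a dense map into a Hilbert module. -/
theorem exists_completion : ∃ (F : Type w) (_ : NormedAddCommGroup F) (_ : NormedSpace ℂ F)
    (_ : Module Cᵐᵒᵖ F) (_ : HilbertModule C F) (j : W →ₗ[ℂ] F), DenseRange j ∧
      ∀ x y, HilbertModule.inner (B := C) (j x) (j y) = s.inner x y := by
  obtain ⟨F, _, _, _, _, j, hj, hnorm, hop, hcont⟩ := s.exists_banach_completion
  -- The inner product is extended one variable at a time, linearly by `L` and then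
  -- conjugate-linearly by `K`; Cauchy–Schwarz gives both bounds. The axioms follow by density.
  let L (x : W) : W →ₗ[ℂ] C :=
    { toFun := s.inner x, map_add' := s.add_right x, map_smul' := fun c y => s.smul_right c x y }
  have hL (x : W) : ∀ y, ‖L x y‖ ≤ ‖j x‖ * ‖j y‖ := fun y => by
    rw [hnorm, hnorm]; exact s.norm_inner_le x y
  have hLj (x y : W) : (L x).extendOfNorm j (j y) = s.inner x y :=
    LinearMap.extendOfNorm_eq hj ⟨_, hL x⟩ y
  let K : W →ₛₗ[starRingEnd ℂ] (F →L[ℂ] C) :=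
    { toFun := fun x => (L x).extendOfNorm j
      map_add' := fun x y => ContinuousLinearMap.coeFn_injective <|
        hj.equalizer (map_continuous _) (map_continuous _) <| funext fun z => by
          simp only [Function.comp_apply, add_apply, hLj, s.add_left]
      map_smul' := fun c x => ContinuousLinearMap.coeFn_injective <|
        hj.equalizer (map_continuous _) (map_continuous _) <| funext fun z => by
          simp only [Function.comp_apply, smul_apply, hLj, s.smul_left]
          rfl }
  have hK : ∀ x, ‖K x‖ ≤ 1 * ‖j x‖ := fun x => by
    rw [one_mul]
    exact LinearMap.opNorm_extendOfNorm_le hj (_root_.norm_nonneg _) (hL x)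
  let I : F →SL[starRingEnd ℂ] (F →L[ℂ] C) := K.extendOfNorm j
  have hI (x y : W) : I (j x) (j y) = s.inner x y := by
    rw [← hLj x y]
    exact DFunLike.congr_fun (LinearMap.extendOfNorm_eq hj ⟨1, hK⟩ x) (j y)
  have hIc : Continuous fun p : F × F => I p.1 p.2 := by fun_prop
  have hIl (y : F) : Continuous fun x : F => I x y := by fun_prop
  refine ⟨F, inferInstance, inferInstance, inferInstance,
    { complete := inferInstance
      inner := fun x y => I x y
      inner_add_right := fun x y z => map_add _ _ _
      inner_smul_right := fun c x y => map_smul _ _ _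
      inner_op_smul_right := fun b x y => ?_
      star_inner := fun x y => ?_
      inner_self_nonneg := fun x => ?_
      norm_eq_sqrt_norm_inner_self := fun x => ?_ }, j, hj, hI⟩
  · refine hj.induction_on₂ (p := fun x y => I x (MulOpposite.op b • y) = I x y * b) ?_ ?_ x y
    · have := hcont (MulOpposite.op b)
      exact isClosed_eq (by fun_prop) (by fun_prop)
    · intro x y
      rw [← hop, hI, hI, s.op_smul_right]
  · refine hj.induction_on₂ (p := fun x y => star (I x y) = I y x) ?_ ?_ x y
    · exact isClosed_eq (by fun_prop) (by fun_prop)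
    · intro x y
      rw [hI, hI, s.star_inner]
  · refine hj.induction_on (p := fun x => 0 ≤ I x x) x ?_ ?_
    · exact CStarAlgebra.isClosed_nonneg.preimage (by fun_prop)
    · intro x
      rw [hI]
      exact s.self_nonneg x
  · refine hj.induction_on (p := fun x => ‖x‖ = √‖I x x‖) x ?_ ?_
    · exact isClosed_eq (by fun_prop) (by fun_prop)
    · intro x
      rw [hI, hnorm, norm]

end SemiInner

/-! ### Inner product calculus in Hilbert modules -/

namespace HilbertModule

variable (B : Type v) {E : Type w} [CStarAlgebra B] [PartialOrder B]
  [NormedAddCommGroup E] [NormedSpace ℂ E] [Module Bᵐᵒᵖ E] [HilbertModule B E]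

variable (E) in
/-- The inner product of a Hilbert module, as a semi-inner product. -/
def semiInner : SemiInner B E where
  inner := HilbertModule.inner
  add_right := HilbertModule.inner_add_right
  smul_right := HilbertModule.inner_smul_right
  op_smul_right := HilbertModule.inner_op_smul_right
  star_inner := HilbertModule.star_inner
  self_nonneg := HilbertModule.inner_self_nonneg

variable {B}

lemma inner_sub_right (x y z : E) : HilbertModule.inner (B := B) x (y - z) =
    HilbertModule.inner x y - HilbertModule.inner x z :=
  (semiInner B E).sub_right x y z

lemma inner_op_smul_left (b : B) (x y : E) :
    HilbertModule.inner (MulOpposite.op b • x) y = star b * HilbertModule.inner x y :=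
  (semiInner B E).op_smul_left b x y

lemma inner_sum_right {ι : Type*} (t : Finset ι) (x : E) (y : ι → E) :
    HilbertModule.inner (B := B) x (∑ i ∈ t, y i) = ∑ i ∈ t, HilbertModule.inner x (y i) :=
  (semiInner B E).sum_right t x y

lemma inner_sum_left {ι : Type*} (t : Finset ι) (x : ι → E) (y : E) :
    HilbertModule.inner (B := B) (∑ i ∈ t, x i) y = ∑ i ∈ t, HilbertModule.inner (x i) y :=
  (semiInner B E).sum_left t x y

lemma star_mul_sum_inner_mul {k : Type*} [Fintype k] (ζ : k → E) (b : B) :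
    star b * (∑ i, HilbertModule.inner (B := B) (ζ i) (ζ i)) * b =
      ∑ i, HilbertModule.inner (B := B) (MulOpposite.op b • ζ i) (MulOpposite.op b • ζ i) := by
  simp only [Finset.mul_sum, Finset.sum_mul, inner_op_smul_left, inner_op_smul_right]

lemma star_sum_inner {k : Type*} [Fintype k] (v w : k → E) :
    star (∑ i, HilbertModule.inner (B := B) (v i) (w i)) =
      ∑ i, HilbertModule.inner (w i) (v i) := by
  simp [star_sum, HilbertModule.star_inner]

/-- The form of a Gram kernel is the square of a `B`-linear combination of the columns `v p`, so
inequalities between Gram kernels are inequalities between such squares. -/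
lemma form_sum_inner {n k : Type*} [Fintype n] [Fintype k] (v : n → k → E) (b : n → B) :
    ∑ p, ∑ q, star (b p) * (∑ i, HilbertModule.inner (B := B) (v p i) (v q i)) * b q =
      ∑ i, HilbertModule.inner (∑ p, MulOpposite.op (b p) • v p i)
        (∑ p, MulOpposite.op (b p) • v p i) := by
  simp only [Finset.mul_sum, Finset.sum_mul, inner_sum_left, inner_sum_right, inner_op_smul_left,
    inner_op_smul_right]
  rw [Finset.sum_comm, eq_comm, Finset.sum_comm]
  exact Finset.sum_congr rfl fun q _ => Finset.sum_comm

variable (B) in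
lemma inner_self_norm (x : E) : ‖HilbertModule.inner (B := B) x x‖ = ‖x‖ ^ 2 := by
  rw [HilbertModule.norm_eq_sqrt_norm_inner_self (B := B) x, Real.sq_sqrt (norm_nonneg _)]

variable (B) in
lemma eq_of_inner_left_eq {x y : E}
    (h : ∀ z : E, HilbertModule.inner (B := B) z x = HilbertModule.inner z y) : x = y := by
  have h1 : HilbertModule.inner (B := B) (x - y) (x - y) = 0 := by
    rw [inner_sub_right, h, sub_self]
  have h2 := inner_self_norm B (x - y)
  rw [h1, norm_zero] at h2
  exact sub_eq_zero.mp (norm_eq_zero.mp (pow_eq_zero_iff two_ne_zero |>.mp h2.symm))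

variable [StarOrderedRing B]

variable (B E) in
/-- The inner product of a Hilbert module, as a continuous sesquilinear map. -/
noncomputable def innerSL : E →SL[starRingEnd ℂ] E →L[ℂ] B :=
  LinearMap.mkContinuous₂
    (LinearMap.mk₂'ₛₗ (starRingEnd ℂ) (RingHom.id ℂ) (HilbertModule.inner (B := B))
      (semiInner B E).add_left (semiInner B E).smul_left HilbertModule.inner_add_right
      fun c x y => HilbertModule.inner_smul_right c x y) 1 fun x y => by
        have hn (z : E) : (semiInner B E).norm z = ‖z‖ :=
          (HilbertModule.norm_eq_sqrt_norm_inner_self (B := B) z).symm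
        rw [one_mul, ← hn, ← hn]
        exact (semiInner B E).norm_inner_le x y

lemma innerSL_apply (x y : E) : innerSL B E x y = HilbertModule.inner x y := rfl

end HilbertModule

namespace LeftAction

variable {A : Type u} {B : Type v} {E : Type w} [CStarAlgebra A]
  [CStarAlgebra B] [PartialOrder B]
  [NormedAddCommGroup E] [NormedSpace ℂ E] [Module Bᵐᵒᵖ E] [HilbertModule B E]

/-- The operator moves to the left variable as its adjoint, where it no longer meets `b`. -/
lemma map_op_smul (σ : LeftAction A B E) (a : A) (b : B) (x : E) :
    σ.toAlgHom a (MulOpposite.op b • x) = MulOpposite.op b • σ.toAlgHom a x := by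
  refine HilbertModule.eq_of_inner_left_eq B fun z => ?_
  have h (y : E) : HilbertModule.inner (B := B) z (σ.toAlgHom a y) =
      HilbertModule.inner (σ.toAlgHom (star a) z) y := by
    rw [σ.adjoint, star_star]
  rw [h, HilbertModule.inner_op_smul_right, HilbertModule.inner_op_smul_right, h]

end LeftAction

/-! ### Operator inequalities and the form induced by a completely positive map -/

section Bounds

variable {B : Type v} {E : Type w} [CStarAlgebra B] [PartialOrder B] [StarOrderedRing B]
  [NormedAddCommGroup E] [NormedSpace ℂ E] [Module Bᵐᵒᵖ E] [HilbertModule B E]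

/-- A right `B`-linear map between spaces of columns that is bounded by `t` on the unit ball
satisfies `⟨T η, T η⟩ ≤ t² ⟨η, η⟩`. -/
lemma HilbertModule.sum_inner_map_le {k l : Type*} [Fintype k] [Fintype l]
    (T : (k → E) → (l → E)) {t : ℝ}
    (hT : ∀ (b : B) (η : k → E), T (fun i => MulOpposite.op b • η i) =
      fun i => MulOpposite.op b • T η i)
    (h : ∀ η : k → E, ‖∑ i, HilbertModule.inner (B := B) (η i) (η i)‖ ≤ 1 →
      ‖∑ i, HilbertModule.inner (B := B) (T η i) (T η i)‖ ≤ t) (η : k → E) :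
    ∑ i, HilbertModule.inner (B := B) (T η i) (T η i) ≤
      t • ∑ i, HilbertModule.inner (B := B) (η i) (η i) := by
  refine CStarAlgebra.le_smul_of_forall_conjugate
    (Finset.sum_nonneg fun i _ => HilbertModule.inner_self_nonneg _)
    (Finset.sum_nonneg fun i _ => HilbertModule.inner_self_nonneg _) fun b hb => ?_
  -- Conjugating by `b` amounts to replacing `η` by `η b`, which `hb` places in the unit ball.
  rw [HilbertModule.star_mul_sum_inner_mul] at hb ⊢
  have := h (fun i => MulOpposite.op b • η i) hb
  rwa [hT] at this

variable {C : Type v} [CStarAlgebra C] [PartialOrder C] [StarOrderedRing C]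

lemma CompletelyPositiveMap.map_star (ψ : B →CP C) (b : B) : ψ (star b) = star (ψ b) :=
  StarHomClass.map_star ψ b

/-- The `C`-valued form on `E →₀ C` induced by a completely positive map `ψ : B → C`. -/
noncomputable def tensorSemiInner (ψ : B →CP C) : SemiInner C (E →₀ C) where
  inner f g := f.sum fun e c => g.sum fun e' c' =>
    star c * ψ (HilbertModule.inner e e') * c'
  add_right f g h := by
    rw [← Finsupp.sum_add]
    refine Finsupp.sum_congr fun e _ => ?_
    exact Finsupp.sum_add_index' (by simp) (by simp [mul_add])
  smul_right r f g := by
    rw [Finsupp.smul_sum]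
    refine Finsupp.sum_congr fun e _ => ?_
    rw [Finsupp.sum_smul_index' (by simp), Finsupp.smul_sum]
    exact Finsupp.sum_congr fun e' _ => by simp
  op_smul_right b f g := by
    rw [Finsupp.sum_mul]
    refine Finsupp.sum_congr fun e _ => ?_
    rw [Finsupp.sum_smul_index' (by simp), Finsupp.sum_mul]
    exact Finsupp.sum_congr fun e' _ => by simp [mul_assoc]
  star_inner f g := by
    simp only [Finsupp.sum, star_sum]
    rw [Finset.sum_comm]
    refine Finset.sum_congr rfl fun e _ => Finset.sum_congr rfl fun e' _ => ?_
    rw [star_mul, star_mul, star_star, ← ψ.map_star, HilbertModule.star_inner, mul_assoc]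
  self_nonneg f := by
    -- The Gram kernel of the support of `f` is positive definite over `B`. The sum over `Unit` is
    -- there because `form_sum_inner` speaks of columns.
    have h := ψ.form_nonneg (n := f.support)
      (G := fun p q => ∑ _i : Unit, HilbertModule.inner (p : E) (q : E))
      (fun p q => HilbertModule.star_sum_inner _ _) (fun b => by
        rw [HilbertModule.form_sum_inner (fun (p : f.support) (_ : Unit) => (p : E))]
        exact Finset.sum_nonneg fun i _ => HilbertModule.inner_self_nonneg _) (fun p => f p)
    simp only [Finset.univ_unique, Finset.sum_singleton] at h
    rw [Finset.sum_coe_sort f.support fun e => ∑ q : f.support,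
      star (f e) * ψ (HilbertModule.inner e q) * f q] at h
    refine h.trans_eq (Finset.sum_congr rfl fun e _ => ?_)
    exact Finset.sum_coe_sort f.support fun q => star (f e) * ψ (HilbertModule.inner e q) * f q

end Bounds

/-! ### Interior tensor products along a completely positive map -/

/-- A superset of the support is allowed so that several elements can be expanded over one index
set. -/
lemma Finsupp.map_eq_sum_single {E C F : Type*} [AddCommGroup C] [Module ℂ C] [AddCommGroup F]
    [Module ℂ F] (j : (E →₀ C) →ₗ[ℂ] F) (f : E →₀ C) {s : Finset E} (hs : f.support ⊆ s) :
    j f = ∑ e : s, j (Finsupp.single (e : E) (f e)) := by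
  conv_lhs => rw [← Finsupp.sum_single f, Finsupp.sum_of_support_subset f hs _ (by simp), map_sum]
  exact (Finset.sum_coe_sort s fun e => j (Finsupp.single e (f e))).symm

/-- `j` is a dense map from the free vector space on `E` with coefficients in `C` into a Hilbert
`C`-module `F` that exhibits `F` as the interior tensor product of `E` and `C` along `ψ`. -/
structure IsInteriorTensor {B C : Type v} {E : Type w} {F : Type*}
    [CStarAlgebra B] [PartialOrder B] [StarOrderedRing B]
    [NormedAddCommGroup E] [NormedSpace ℂ E] [Module Bᵐᵒᵖ E] [HilbertModule B E]
    [CStarAlgebra C] [PartialOrder C] [StarOrderedRing C]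
    [NormedAddCommGroup F] [NormedSpace ℂ F] [Module Cᵐᵒᵖ F] [HilbertModule C F]
    (ψ : B →CP C) (j : (E →₀ C) →ₗ[ℂ] F) : Prop where
  dense : DenseRange j
  inner_single : ∀ (e e' : E) (c c' : C), HilbertModule.inner (B := C)
    (j (Finsupp.single e c)) (j (Finsupp.single e' c')) =
      star c * ψ (HilbertModule.inner e e') * c'

theorem exists_isInteriorTensor {B C : Type v} (E : Type w)
    [CStarAlgebra B] [PartialOrder B] [StarOrderedRing B]
    [NormedAddCommGroup E] [NormedSpace ℂ E] [Module Bᵐᵒᵖ E] [HilbertModule B E]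
    [CStarAlgebra C] [PartialOrder C] [StarOrderedRing C] (ψ : B →CP C) :
    ∃ (F : Type (max v w)) (_ : NormedAddCommGroup F) (_ : NormedSpace ℂ F) (_ : Module Cᵐᵒᵖ F)
      (_ : HilbertModule C F) (j : (E →₀ C) →ₗ[ℂ] F), IsInteriorTensor ψ j := by
  obtain ⟨F, h1, h2, h3, h4, j, hj, hinner⟩ :=
    (tensorSemiInner (E := E) ψ).exists_completion
  refine ⟨F, h1, h2, h3, h4, j, hj, fun e e' c c' => ?_⟩
  rw [hinner]
  simp [tensorSemiInner]

namespace IsInteriorTensor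

variable {B C : Type v} {E : Type w} {F : Type*}
  [CStarAlgebra B] [PartialOrder B] [StarOrderedRing B]
  [NormedAddCommGroup E] [NormedSpace ℂ E] [Module Bᵐᵒᵖ E] [HilbertModule B E]
  [CStarAlgebra C] [PartialOrder C] [StarOrderedRing C]
  [NormedAddCommGroup F] [NormedSpace ℂ F] [Module Cᵐᵒᵖ F] [HilbertModule C F]
  {ψ : B →CP C} {j : (E →₀ C) →ₗ[ℂ] F} (hj : IsInteriorTensor ψ j)

include hj

lemma clm_ext {G : Type*} [NormedAddCommGroup G] [NormedSpace ℂ G] {S T : F →L[ℂ] G}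
    (h : ∀ (e : E) (c : C), S (j (Finsupp.single e c)) = T (j (Finsupp.single e c))) : S = T := by
  have h1 : S.toLinearMap ∘ₗ j = T.toLinearMap ∘ₗ j := Finsupp.lhom_ext h
  exact ContinuousLinearMap.coeFn_injective <| hj.dense.equalizer S.continuous T.continuous <|
    funext fun f => LinearMap.congr_fun h1 f

lemma ext_inner {x y : F} (h : ∀ (e : E) (c : C),
    HilbertModule.inner (B := C) (j (Finsupp.single e c)) x =
      HilbertModule.inner (j (Finsupp.single e c)) y) : x = y := by
  refine HilbertModule.eq_of_inner_left_eq C fun z => ?_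
  have h1 : HilbertModule.innerSL C F x = HilbertModule.innerSL C F y := hj.clm_ext fun e c => by
    have := congrArg star (h e c)
    rwa [HilbertModule.star_inner, HilbertModule.star_inner] at this
  have := congrArg star (DFunLike.congr_fun h1 z)
  rwa [HilbertModule.innerSL_apply, HilbertModule.innerSL_apply, HilbertModule.star_inner,
    HilbertModule.star_inner] at this

/-- `E →₀ C` is free on the set `E`, so additivity in `e` appears only in `F`, where vectors are
separated by their inner products with elementary tensors. -/
lemma single_add_left (e e' : E) (c : C) : j (Finsupp.single (e + e') c) =
    j (Finsupp.single e c) + j (Finsupp.single e' c) :=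
  hj.ext_inner fun d b => by
    simp only [HilbertModule.inner_add_right, hj.inner_single, map_add, mul_add, add_mul]

lemma single_smul_left (r : ℂ) (e : E) (c : C) : j (Finsupp.single (r • e) c) =
    r • j (Finsupp.single e c) :=
  hj.ext_inner fun d b => by
    simp only [HilbertModule.inner_smul_right, hj.inner_single, map_smul, mul_smul_comm,
      smul_mul_assoc]

lemma single_zero_left (c : C) : j (Finsupp.single 0 c) = 0 := by
  simpa using hj.single_smul_left 0 0 c

lemma single_sub_left (e e' : E) (c : C) : j (Finsupp.single (e - e') c) =
    j (Finsupp.single e c) - j (Finsupp.single e' c) := by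
  rw [eq_sub_iff_add_eq, ← hj.single_add_left, sub_add_cancel]

lemma sum_inner_eq {n k : Type*} [Fintype n] [Fintype k] (u : n → k → E) (c : n → C) :
    ∑ i, HilbertModule.inner (B := C) (∑ p, j (Finsupp.single (u p i) (c p)))
        (∑ p, j (Finsupp.single (u p i) (c p))) =
      ∑ p, ∑ q, star (c p) * ψ (∑ i, HilbertModule.inner (u p i) (u q i)) * c q := by
  simp only [HilbertModule.inner_sum_left, HilbertModule.inner_sum_right, hj.inner_single,
    map_sum, Finset.mul_sum, Finset.sum_mul]
  rw [eq_comm, Finset.sum_comm, eq_comm, Finset.sum_comm]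
  exact Finset.sum_congr rfl fun q _ => Finset.sum_comm

/-- An inequality between Gram kernels over `B` passes to the interior tensor product. -/
lemma sum_inner_le {n k l : Type*} [Fintype n] [Fintype k] [Fintype l]
    (v : n → k → E) (w : n → l → E) (t : ℝ)
    (h : ∀ b : n → B,
      ∑ i, HilbertModule.inner (B := B) (∑ p, MulOpposite.op (b p) • w p i)
        (∑ p, MulOpposite.op (b p) • w p i) ≤
      t • ∑ i, HilbertModule.inner (B := B) (∑ p, MulOpposite.op (b p) • v p i)
        (∑ p, MulOpposite.op (b p) • v p i)) (c : n → C) :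
    ∑ i, HilbertModule.inner (B := C) (∑ p, j (Finsupp.single (w p i) (c p)))
        (∑ p, j (Finsupp.single (w p i) (c p))) ≤
      t • ∑ i, HilbertModule.inner (B := C) (∑ p, j (Finsupp.single (v p i) (c p)))
        (∑ p, j (Finsupp.single (v p i) (c p))) := by
  have hψ (b : B) : ψ (t • b) = t • ψ b := by
    rw [← Complex.coe_smul, map_smul, Complex.coe_smul]
  -- The hypothesis says exactly that this difference of Gram kernels is positive definite over `B`.
  have key := ψ.form_nonneg (G := fun p q =>
    t • ∑ i, HilbertModule.inner (v p i) (v q i) - ∑ i, HilbertModule.inner (w p i) (w q i))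
    (fun p q => by
      rw [star_sub, star_smul, star_trivial, HilbertModule.star_sum_inner,
        HilbertModule.star_sum_inner])
    (fun b => by
      simp only [mul_sub, sub_mul, Finset.sum_sub_distrib, mul_smul_comm, smul_mul_assoc,
        ← Finset.smul_sum]
      rw [HilbertModule.form_sum_inner, HilbertModule.form_sum_inner]
      exact sub_nonneg.mpr (h b)) c
  simp only [map_sub, hψ, mul_sub, sub_mul, Finset.sum_sub_distrib, mul_smul_comm, smul_mul_assoc,
    ← Finset.smul_sum] at key
  rw [hj.sum_inner_eq, hj.sum_inner_eq]
  exact sub_nonneg.mp key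

/-- This bound makes `T ⊗ id` well defined on `F`. It is the kernel form of `⟨Tη, Tη⟩ ≤ ‖T‖² ⟨η, η⟩`
over the support of `f`, pushed through `ψ`. -/
lemma norm_map_lmapDomain_le {T : E →L[ℂ] E}
    (hT : ∀ (b : B) (x : E), T (MulOpposite.op b • x) = MulOpposite.op b • T x) (f : E →₀ C) :
    ‖j (Finsupp.lmapDomain C ℂ T f)‖ ≤ ‖T‖ * ‖j f‖ := by
  have h1 := HilbertModule.sum_inner_map_le (B := B) (k := Unit) (l := Unit) (t := ‖T‖ ^ 2)
    (fun η i => T (η i)) (fun b η => funext fun i => hT b _) (fun η hη => by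
      simp only [Finset.univ_unique, Finset.sum_singleton, HilbertModule.inner_self_norm] at hη ⊢
      have hη' : ‖η default‖ ≤ 1 := (sq_le_one_iff₀ (norm_nonneg _)).mp hη
      exact pow_le_pow_left₀ (norm_nonneg _) (T.unit_le_opNorm _ hη') 2)
  have h2 := hj.sum_inner_le (n := f.support) (fun p (_ : Unit) => (p : E))
    (fun p (_ : Unit) => T p) (‖T‖ ^ 2) (fun b => by
      simpa only [map_sum, hT] using h1 fun _ => ∑ p, MulOpposite.op (b p) • (p : E))
    (fun p => f p)
  have h3 : j (Finsupp.lmapDomain C ℂ T f) =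
      ∑ p : f.support, j (Finsupp.single (T (p : E)) (f p)) := by
    conv_lhs => rw [Finsupp.lmapDomain_apply, Finsupp.mapDomain, Finsupp.sum, map_sum]
    exact (Finset.sum_coe_sort f.support fun e => j (Finsupp.single (T e) (f e))).symm
  simp only [← h3, ← Finsupp.map_eq_sum_single j f subset_rfl, Finset.univ_unique,
    Finset.sum_singleton] at h2
  have h4 := CStarAlgebra.norm_le_norm_of_nonneg_of_le (HilbertModule.inner_self_nonneg _) h2
  rw [norm_smul, HilbertModule.inner_self_norm, HilbertModule.inner_self_norm,
    Real.norm_of_nonneg (sq_nonneg _), ← mul_pow] at h4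
  exact (pow_le_pow_iff_left₀ (norm_nonneg _) (by positivity) two_ne_zero).mp h4

lemma exists_lift (T : E →L[ℂ] E)
    (hT : ∀ (b : B) (x : E), T (MulOpposite.op b • x) = MulOpposite.op b • T x) :
    ∃ S : F →L[ℂ] F, ∀ (e : E) (c : C), S (j (Finsupp.single e c)) = j (Finsupp.single (T e) c) := by
  have := HilbertModule.complete (B := C) (E := F)
  refine ⟨(j ∘ₗ Finsupp.lmapDomain C ℂ T).extendOfNorm j, fun e c => ?_⟩
  rw [LinearMap.extendOfNorm_eq hj.dense ⟨‖T‖, hj.norm_map_lmapDomain_le hT⟩]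
  simp

lemma exists_leftAction {A : Type u} [CStarAlgebra A] (σ : LeftAction A B E) :
    ∃ τ : LeftAction A C F, ∀ (a : A) (e : E) (c : C),
      τ.toAlgHom a (j (Finsupp.single e c)) = j (Finsupp.single (σ.toAlgHom a e) c) := by
  choose S hS using fun a : A => hj.exists_lift (σ.toAlgHom a) (σ.map_op_smul a)
  let S' : A →ₗ[ℂ] (F →L[ℂ] F) :=
    { toFun := S
      map_add' := fun a b => hj.clm_ext fun e c => by
        simp only [hS, map_add, add_apply, hj.single_add_left]
      map_smul' := fun r a => hj.clm_ext fun e c => by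
        simp only [hS, map_smul, smul_apply, hj.single_smul_left, RingHom.id_apply] }
  refine ⟨⟨AlgHom.ofLinearMap S' (hj.clm_ext fun e c => ?_)
    fun a b => hj.clm_ext fun e c => ?_, fun a x y => ?_⟩, hS⟩
  · change S 1 _ = _
    simp [hS]
  · change S (a * b) _ = S a (S b _)
    simp [hS]
  · change HilbertModule.inner (S a x) y = HilbertModule.inner x (S (star a) y)
    -- The adjoint relation is checked on elementary tensors and extended to `F` in the first
    -- variable here, in the second in `h2`.
    have h1 (x : F) (e' : E) (c' : C) : HilbertModule.inner (B := C) (S a x)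
        (j (Finsupp.single e' c')) =
          HilbertModule.inner x (S (star a) (j (Finsupp.single e' c'))) := by
      have : (HilbertModule.innerSL C F (j (Finsupp.single e' c'))).comp (S a) =
          HilbertModule.innerSL C F (S (star a) (j (Finsupp.single e' c'))) :=
        hj.clm_ext fun e c => by
          simp only [ContinuousLinearMap.comp_apply, HilbertModule.innerSL_apply, hS,
            hj.inner_single]
          rw [σ.adjoint, star_star]
      have := congrArg star (DFunLike.congr_fun this x)
      simpa only [ContinuousLinearMap.comp_apply, HilbertModule.innerSL_apply,
        HilbertModule.star_inner] using this
    have h2 : HilbertModule.innerSL C F (S a x) =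
        (HilbertModule.innerSL C F x).comp (S (star a)) := hj.clm_ext fun e c => h1 x e c
    exact DFunLike.congr_fun h2 y

end IsInteriorTensor

/-! ### Completely bounded norms on the interior tensor product -/

section CBNorm

variable {A : Type u} {B C : Type v} {E : Type w} {F : Type*}
  [CStarAlgebra A] [PartialOrder A] [StarOrderedRing A]
  [CStarAlgebra B] [PartialOrder B]
  [NormedAddCommGroup E] [NormedSpace ℂ E] [Module Bᵐᵒᵖ E] [HilbertModule B E]

lemma colNorm_le_iff {n : ℕ} {ξ : Fin n → E} {t : ℝ} (ht : 0 ≤ t) :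
    colNorm B ξ ≤ t ↔ ‖∑ i, HilbertModule.inner (B := B) (ξ i) (ξ i)‖ ≤ t ^ 2 :=
  Real.sqrt_le_left ht

lemma colNorm_ampliation_le {D : A → (E →L[ℂ] E)} (h : cbNorm B D ≠ ⊤) {n : ℕ}
    {M : CStarMatrix (Fin n) (Fin n) A} (hM : ‖M‖ ≤ 1) {ξ : Fin n → E} (hξ : colNorm B ξ ≤ 1) :
    colNorm B (ampliation D M ξ) ≤ (cbNorm B D).toReal := by
  have : ENNReal.ofReal (colNorm B (ampliation D M ξ)) ≤ cbNorm B D :=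
    le_iSup_of_le n <| le_iSup_of_le M <| le_iSup_of_le hM <| le_iSup_of_le ξ <|
      le_iSup_of_le hξ le_rfl
  exact (ENNReal.ofReal_le_iff_le_toReal h).mp this

variable [StarOrderedRing B] [CStarAlgebra C] [PartialOrder C] [StarOrderedRing C]
  [NormedAddCommGroup F] [NormedSpace ℂ F] [Module Cᵐᵒᵖ F] [HilbertModule C F]

/-- Tensoring with the identity does not increase completely bounded norms. -/
theorem IsInteriorTensor.cbNorm_le {ψ : B →CP C} {j : (E →₀ C) →ₗ[ℂ] F}
    (hj : IsInteriorTensor ψ j) {D : A → (E →L[ℂ] E)} {D' : A → (F →L[ℂ] F)}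
    (hD : ∀ (a : A) (b : B) (x : E), D a (MulOpposite.op b • x) = MulOpposite.op b • D a x)
    (hD' : ∀ (a : A) (e : E) (c : C),
      D' a (j (Finsupp.single e c)) = j (Finsupp.single (D a e) c)) :
    cbNorm C D' ≤ cbNorm B D := by
  classical
  by_cases htop : cbNorm B D = ⊤
  · rw [htop]
    exact le_top
  set t := (cbNorm B D).toReal with ht
  have ht0 : 0 ≤ t := ENNReal.toReal_nonneg
  refine iSup_le fun n => iSup_le fun M => iSup_le fun hM => iSup_le fun ξ => iSup_le fun hξ => ?_
  rw [← ENNReal.ofReal_toReal htop, ← ht]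
  refine ENNReal.ofReal_le_ofReal ?_
  -- The ampliation is right `B`-linear, so its norm bound becomes an inequality in `B`, the form
  -- that `ψ` can transport.
  have hbound (η : Fin n → E) :
      ∑ i, HilbertModule.inner (B := B) (ampliation D M η i) (ampliation D M η i) ≤
        t ^ 2 • ∑ i, HilbertModule.inner (B := B) (η i) (η i) := by
    refine HilbertModule.sum_inner_map_le (ampliation D M) (fun b η => ?_) (fun η hη => ?_) η
    · funext i
      simp only [ampliation, hD, Finset.smul_sum]
    · refine (colNorm_le_iff ht0).mp (colNorm_ampliation_le htop hM ?_)
      rw [colNorm_le_iff zero_le_one]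
      simpa using hη
  have hdense (f : Fin n → (E →₀ C)) :
      ∑ i, HilbertModule.inner (B := C) (ampliation D' M (fun k => j (f k)) i)
          (ampliation D' M (fun k => j (f k)) i) ≤
        t ^ 2 • ∑ i, HilbertModule.inner (B := C) (j (f i)) (j (f i)) := by
    let s : Finset E := Finset.univ.biUnion fun k => (f k).support
    have hs (k : Fin n) : (f k).support ⊆ s :=
      Finset.subset_biUnion_of_mem (fun k => (f k).support) (Finset.mem_univ k)
    -- The index `(k, e)` stands for the column with `e` in position `k` and zeros elsewhere; its
    -- image under the ampliation has `i`-th entry `D (M i k) e`. `B`-combinations of these are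
    -- columns in `Eⁿ`, to which `hbound` applies.
    have h := hj.sum_inner_le (n := Fin n × s) (k := Fin n) (l := Fin n)
      (fun p i => if i = p.1 then (p.2 : E) else 0) (fun p i => D (M i p.1) p.2) (t ^ 2)
      (fun b => by
        convert hbound fun k => ∑ e : s, MulOpposite.op (b (k, e)) • (e : E) using 4 with i _ i _
        all_goals
          simp [ampliation, Fintype.sum_prod_type, hD])
      (fun p => f p.1 p.2)
    have hv (i : Fin n) : ∑ p : Fin n × s, j (Finsupp.single
        (if i = p.1 then (p.2 : E) else 0) (f p.1 p.2)) = j (f i) := by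
      rw [Fintype.sum_prod_type, Finset.sum_eq_single i, Finsupp.map_eq_sum_single j (f i) (hs i)]
      · simp
      · intro k _ hk
        simp [hk.symm, hj.single_zero_left]
      · simp
    have hw (i : Fin n) : ∑ p : Fin n × s, j (Finsupp.single (D (M i p.1) p.2) (f p.1 p.2)) =
        ampliation D' M (fun k => j (f k)) i := by
      rw [Fintype.sum_prod_type, ampliation]
      refine Finset.sum_congr rfl fun k _ => ?_
      rw [Finsupp.map_eq_sum_single j (f k) (hs k), map_sum]
      simp only [hD']
    simpa only [hv, hw] using h
  have hall (ζ : Fin n → F) :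
      ‖∑ i, HilbertModule.innerSL C F (ampliation D' M ζ i) (ampliation D' M ζ i)‖ ≤
        t ^ 2 * ‖∑ i, HilbertModule.innerSL C F (ζ i) (ζ i)‖ := by
    have hd : DenseRange fun (f : Fin n → (E →₀ C)) (k : Fin n) => j (f k) :=
      DenseRange.piMap fun _ => hj.dense
    refine hd.induction_on ζ (isClosed_le ?_ ?_) fun f => ?_
    · unfold ampliation
      fun_prop
    · fun_prop
    · have h := CStarAlgebra.norm_le_norm_of_nonneg_of_le
        (Finset.sum_nonneg fun i _ => HilbertModule.inner_self_nonneg _) (hdense f)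
      rwa [norm_smul, Real.norm_of_nonneg (sq_nonneg t)] at h
  rw [colNorm_le_iff ht0]
  rw [colNorm_le_iff zero_le_one, one_pow] at hξ
  calc _ ≤ t ^ 2 * _ := hall ξ
    _ ≤ t ^ 2 * 1 := by gcongr; exact hξ
    _ = t ^ 2 := mul_one _

end CBNorm

/-! ### Monotonicity of the representation metric and the theorem -/

/-- The representation metric decreases under unital completely positive maps. -/
theorem representationMetric_comp_le {A : Type u} {B C : Type v}
    [CStarAlgebra A] [PartialOrder A] [StarOrderedRing A]
    [CStarAlgebra B] [PartialOrder B] [StarOrderedRing B]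
    [CStarAlgebra C] [PartialOrder C] [StarOrderedRing C]
    (ψ : UCPMap B C) (φ₁ φ₂ : UCPMap A B) :
    representationMetric (ψ.comp φ₁) (ψ.comp φ₂) ≤ representationMetric φ₁ φ₂ := by
  refine le_sInf ?_
  rintro _ ⟨E, _, _, _, _, σ₁, σ₂, x, hx, rfl⟩
  -- `F` stays in `Type (max u v)`, so it is an admissible carrier in the infimum.
  obtain ⟨F, _, _, _, _, j, hj⟩ := exists_isInteriorTensor.{v, max u v} E ψ.toCompletelyPositiveMap
  obtain ⟨τ₁, hτ₁⟩ := hj.exists_leftAction σ₁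
  obtain ⟨τ₂, hτ₂⟩ := hj.exists_leftAction σ₂
  -- Unitality of `ψ` is what makes `x ⊗ 1` a unit vector.
  have hone : ψ.toCompletelyPositiveMap 1 = 1 := ψ.map_one'
  have hrep : IsJointRepresentation (ψ.comp φ₁) (ψ.comp φ₂) τ₁ τ₂ (j (Finsupp.single x 1)) := by
    refine ⟨?_, fun a => ?_, fun a => ?_⟩
    · rw [hj.inner_single, hx.unit, hone, star_one, one_mul, one_mul]
    · rw [hτ₁, hj.inner_single, ← hx.left, star_one, one_mul, mul_one]
      rfl
    · rw [hτ₂, hj.inner_single, ← hx.right, star_one, one_mul, mul_one]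
      rfl
  have hcb : cbNorm C (fun a => τ₁.toAlgHom a - τ₂.toAlgHom a) ≤
      cbNorm B (fun a => σ₁.toAlgHom a - σ₂.toAlgHom a) := by
    refine hj.cbNorm_le (fun a b y => ?_) fun a e c => ?_
    · simp only [sub_apply, LeftAction.map_op_smul, smul_sub]
    · simp only [sub_apply, hτ₁, hτ₂, hj.single_sub_left]
  refine le_trans (sInf_le ?_) hcb
  exact ⟨F, _, _, _, _, τ₁, τ₂, _, hrep, rfl⟩

theorem mainTheorem8 {A : Type u} {B H : Type v}
    [CStarAlgebra A] [PartialOrder A] [StarOrderedRing A]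
    [CStarAlgebra B] [PartialOrder B] [StarOrderedRing B]
    [NormedAddCommGroup H] [InnerProductSpace ℂ H] [CompleteSpace H]
    (hB : IsInjectiveCStarAlgebra B)
    (ι : B →⋆ₐ[ℂ] (H →L[ℂ] H)) (hι : Function.Injective ι)
    (φ₁ φ₂ : UCPMap A B) :
    representationMetric ((UCPMap.ofStarAlgHom ι).comp φ₁) ((UCPMap.ofStarAlgHom ι).comp φ₂) =
      representationMetric φ₁ φ₂ := by
  refine le_antisymm (representationMetric_comp_le _ _ _) ?_
  -- Extending the identity of `B` along `ι` gives a completely positive left inverse `P`, which is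
  -- unital because `P 1 = P (ι 1) = 1`.
  obtain ⟨P, hP⟩ := hB B (H →L[ℂ] H) ι hι
    (UCPMap.ofStarAlgHom (StarAlgHom.id ℂ B)).toCompletelyPositiveMap
  have hP' (b : B) : P (ι b) = b := hP b
  let Q : UCPMap (H →L[ℂ] H) B :=
    { P with map_one' := (congrArg P (map_one ι)).symm.trans (hP' 1) }
  have hQ (φ : UCPMap A B) : Q.comp ((UCPMap.ofStarAlgHom ι).comp φ) = φ :=
    DFunLike.ext _ _ fun a => hP' (φ a)
  calc representationMetric φ₁ φ₂
      = representationMetric (Q.comp ((UCPMap.ofStarAlgHom ι).comp φ₁))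
        (Q.comp ((UCPMap.ofStarAlgHom ι).comp φ₂)) := by rw [hQ, hQ]
    _ ≤ _ := representationMetric_comp_le _ _ _
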